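/- **Setting.** Let $\mathcal F$ (fields) and $E$ (gauge parameters) be real Hausdorff locally convex spaces, $C^1$ being meant in the sense of Bastiani. Let $G$ be a $C^1$ Lie group modelled on $E$ (the gauge group), with Lie algebra $\mathfrak g=T_1G\cong E$, acting on a set $P\subset\mathcal F$ of field configurations (the prephase space) by $\phi\mapsto T_g[\phi]$. In a chart of $G$ write $g=g(\alpha)$, $T_\alpha=T_{g(\alpha)}$; assume that $\alpha\mapsto T_\alpha[\phi]\in\mathcal F$ is $C^1$ for every $\phi\in P$ and every chart. (A right action is a left action of the opposite group.) For $\lambda\in\mathfrak g$ let $V_\lambda(\phi)\in\mathcal F$ be the infinitesimal gauge transformation of $\phi$, the derivative of $g\mapsto T_g[\phi]$ at $g=1$ along $\lambda$. Fix $\bar\phi\in P$ and let $\mathcal O=\{T_g[\bar\phi]\}$ be its gauge orbit, with tangent space $T_\phi\mathcal O=\operatorname{span}\{V_\lambda(\phi):\lambda\in\mathfrak g\}$. A $p$-form on $\mathcal O$ assigns to each $\phi\in\mathcal O$ an alternating $p$-linear map on $T_\phi\mathcal O$; $\delta\phi$ is the $\mathcal F$-valued 1-form given by the inclusion $T_\phi\mathcal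 O\subset\mathcal F$, and $\delta$ acts on functions as the differential. Write $\delta_{\delta\alpha}\phi$ for the derivative of $\alpha\mapsto T_\alpha[\bar\phi]$ along $\delta\alpha$. Let $w_\alpha(\delta\alpha)\in\mathfrak g$ be the derivative at $\alpha'=\alpha$ along $\delta\alpha$ of $\alpha'\mapsto g(\alpha')g(\alpha)^{-1}$ (that is, $w=\delta T_\alpha\,T_\alpha^{-1}$). A *transfer field* is a 1-form valued vector field $W$ (a family of linear maps $W_\phi:T_\phi\mathcal O\to T_\phi\mathcal O$) generating the gauge transformation with parameter $w$: at $\phi=T_\alpha[\bar\phi]$, $W_\phi(\delta_{\delta\alpha}\phi)=V_{w_\alpha(\delta\alpha)}(\phi)$ whenever $\delta_{\delta\alpha}\phi\in T_\phi\mathcal O$. The contraction is $(i_WZ)(u_1,\dots,u_p)=\sum_k Z(u_1,\dots,W u_k,\dots,u_p)$. **Theorem.** 1. At $\phi=T_\alpha[\bar\phi]$ one has $\delta_{\delta\alpha}\phi=V_{w_\alpha(\delta\alpha)}(\phi)$. There is exactly one transfer field $W$, and $\delta\phi=i_W\delta\phi$ on $\mathcal O$. 2. $i_WZ=pZ$ for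 every $p\ge 0$ and every $p$-form $Z$ on $\mathcal O$ (with values in any real vector space). 3. $i_W(a\wedge b)=-\left[\,b\wedge i_Wa-a\wedge i_Wb\,\right]$ for all real 1-forms $a,b$ on $\mathcal O$. 4. Let $\Omega$ be a real 2-form on $\mathcal O$ (for instance the presymplectic form restricted to the orbit), and suppose that for each $\lambda\in\mathfrak g$ there is a Noether charge $H[\lambda]:\mathcal O\to\mathbb R$, i.e. a function with a variation $\delta H[\lambda]$ satisfying $i_{V_\lambda}\Omega=-\delta H[\lambda]$. Then $$i_W\Omega=(\delta H[\tilde w])|_{\tilde w=w},\qquad \Omega=\tfrac12(\delta H[\tilde w])|_{\tilde w=w},$$ where $\tilde w$ is held fixed in the variation and then replaced by $w$ placed to the right: on the variations $u_i=\delta_{\delta\alpha_i}\phi$ at $\phi=T_\alpha[\bar\phi]$ ($i=1,2$), with $w_i=w_\alpha(\delta\alpha_i)$, $(\delta H[\tilde w])|_{\tilde w=w}(u_1,u_2)=\delta H[w_2](u_1)-\delta H[w_1](u_2)$. 5. The formula for $\Omega$ also holds with state-dependent parameters: if $\xi_1,\xi_2:\mathcal O\to\mathfrak g$ have charges $h_i$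 with $i_{V_{\xi_i}}\Omega=-\delta h_i$, and $\xi_i(\phi)=w_i$ at the point $\phi=T_\alpha[\bar\phi]$, then $\Omega(u_1,u_2)=\tfrac12\left(\delta h_2(u_1)-\delta h_1(u_2)\right)$ there. -/

import Mathlib

open Filter Topology Set

/-! ### Differential calculus in real topological vector spaces

Spaces of fields and of gauge parameters (smooth sections, vector fields, ...) are in general
locally convex but not normed, so the standard (Bastiani) notion of `C¹` map is used: directional
derivatives exist, are linear in the direction, and depend jointly continuously on the base point
and the direction. -/

section Calculus

variable {X Y : Type*} [AddCommGroup X] [Module ℝ X] [AddCommGroup Y] [Module ℝ Y]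
  [TopologicalSpace Y]

/-- `y` is the derivative of `f` at `x` in the direction `v`. -/
def HasDirDeriv (f : X → Y) (y : Y) (x v : X) : Prop :=
  Tendsto (fun t : ℝ => t⁻¹ • (f (x + t • v) - f x)) (𝓝[≠] (0 : ℝ)) (𝓝 y)

/-- The derivative of `f` at `x` in the direction `v` (meaningful when it exists). -/
noncomputable def dirDeriv (f : X → Y) (x v : X) : Y :=
  limUnder (𝓝[≠] (0 : ℝ)) (fun t : ℝ => t⁻¹ • (f (x + t • v) - f x))

/-- `f` is of class `C¹`, in the sense of Bastiani, on the open set `s`. -/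
def IsC1On [TopologicalSpace X] (f : X → Y) (s : Set X) : Prop :=
  IsOpen s ∧ ∃ f' : X → (X →ₗ[ℝ] Y),
    (∀ x ∈ s, ∀ v, HasDirDeriv f (f' x v) x v) ∧
      ContinuousOn (fun q : X × X => f' q.1 q.2) (s ×ˢ univ)

end Calculus

/-! ### Gauge groups and their action on fields -/

section Gauge

/-- `G` is a Lie group of class (at least) `C¹` modelled on the topological vector space `E`:
read in any charts, `(g, h) ↦ g h⁻¹` is of class `C¹`. Charts are the gauge parameters `α`. -/
class IsC1LieGroup (E G : Type*) [AddCommGroup E] [Module ℝ E] [TopologicalSpace E]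
    [Group G] [TopologicalSpace G] [ChartedSpace E G] : Prop extends IsTopologicalGroup G where
  c1_div : ∀ c₁ ∈ atlas E G, ∀ c₂ ∈ atlas E G, ∀ c₃ ∈ atlas E G,
    IsC1On (fun q : E × E => c₃ (c₁.symm q.1 * (c₂.symm q.2)⁻¹))
      {q | q.1 ∈ c₁.target ∧ q.2 ∈ c₂.target ∧ c₁.symm q.1 * (c₂.symm q.2)⁻¹ ∈ c₃.source}

variable {E F : Type*} [AddCommGroup E] [Module ℝ E] [TopologicalSpace E]
  [AddCommGroup F] [Module ℝ F] [TopologicalSpace F]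
  {G : Type*} [Group G] [TopologicalSpace G] [ChartedSpace E G]
  {P : Set F} [MulAction G P]

variable (E G P) in
/-- The gauge group `G` acts on the prephase space `P` (a set of field configurations inside the
space `F` of all fields) so that `T_α[φ]` is a `C¹` function of the gauge parameter `α`. -/
def IsC1Action : Prop :=
  ∀ φ : P, ∀ c ∈ atlas E G, IsC1On (fun α : E => ((c.symm α • φ : P) : F)) c.target

variable (G) in
/-- The infinitesimal gauge transformation `V_lam` at `φ`, for the Lie algebra element `lam`.
The Lie algebra `T₁G` is identified with `E` by the preferred chart at the identity. -/
noncomputable def generator (lam : E) (φ : P) : F :=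
  dirDeriv (fun β : E => (((chartAt E (1 : G)).symm β • φ : P) : F)) (chartAt E (1 : G) 1) lam

/-- The `1`-form valued gauge parameter `w = δT_α ∘ T_α⁻¹`, in the gauge parameters `α` given by
the chart `c`: its value at `α` on the variation `dα`. -/
noncomputable def gaugeForm (c : OpenPartialHomeomorph G E) (α dα : E) : E :=
  dirDeriv (fun α' : E => chartAt E (1 : G) (c.symm α' * (c.symm α)⁻¹)) α dα

/-- The variation `δφ` of `φ = T_α[φ₀]` (with `φ₀` fixed) produced by the variation `dα`. -/
noncomputable def fieldVariation (φ₀ : P) (c : OpenPartialHomeomorph G E) (α dα : E) : F :=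
  dirDeriv (fun α' : E => ((c.symm α' • φ₀ : P) : F)) α dα

variable (E G) in
/-- The tangent space at `φ` of the gauge orbit through `φ`. -/
noncomputable def orbitTangent (φ : P) : Submodule ℝ F :=
  Submodule.span ℝ (range fun lam : E => generator G lam φ)

variable (G) in
/-- `V_lam` as a tangent vector of the gauge orbit. -/
noncomputable def generatorVec (lam : E) (φ : P) : orbitTangent E G φ :=
  ⟨generator G lam φ, Submodule.subset_span ⟨lam, rfl⟩⟩

/-- The point `T_α[φ₀]` of the gauge orbit of `φ₀`. -/
def orbitPoint (φ₀ : P) (c : OpenPartialHomeomorph G E) (α : E) : MulAction.orbit G φ₀ :=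
  ⟨c.symm α • φ₀, MulAction.mem_orbit φ₀ (c.symm α)⟩

/-! ### Forms on a gauge orbit -/

variable (E G) in
/-- `p`-forms on the gauge orbit of `φ₀` with values in `N`. -/
abbrev OrbitForm (φ₀ : P) (p : ℕ) (N : Type*) [AddCommGroup N] [Module ℝ N] : Type _ :=
  ∀ ψ : MulAction.orbit G φ₀, (orbitTangent E G (ψ : P)) [⋀^Fin p]→ₗ[ℝ] N

variable (E G) in
/-- `1`-form valued vector fields, i.e. `(1,1)` tensors, on the gauge orbit of `φ₀`. -/
abbrev OrbitTensor (φ₀ : P) : Type _ :=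
  ∀ ψ : MulAction.orbit G φ₀, orbitTangent E G (ψ : P) →ₗ[ℝ] orbitTangent E G (ψ : P)

end Gauge

section Algebra

variable {M N : Type*} [AddCommGroup M] [Module ℝ M] [AddCommGroup N] [Module ℝ N]

/-- The contraction `i_W Z` of a `p`-form with a `1`-form valued vector `W`: the degree-zero
derivation replacing each factor `a` of a wedge product in turn by `i_W a = a ∘ W`. -/
noncomputable def insertTensor {p : ℕ} (W : M →ₗ[ℝ] M) (Z : M [⋀^Fin p]→ₗ[ℝ] N) :
    M [⋀^Fin p]→ₗ[ℝ] N where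
  toFun v := ∑ k, Z (Function.update v k (W (v k)))
  map_update_add' := by
    intro _ v i x y
    cases Subsingleton.elim ‹DecidableEq (Fin p)› (instDecidableEqFin p)
    rw [← Finset.sum_add_distrib]
    refine Finset.sum_congr rfl fun k _ => ?_
    by_cases h : k = i
    · subst h; simp
    · simp [Function.update_of_ne h, Function.update_comm (Ne.symm h)]
  map_update_smul' := by
    intro _ v i a x
    cases Subsingleton.elim ‹DecidableEq (Fin p)› (instDecidableEqFin p)
    rw [Finset.smul_sum]
    refine Finset.sum_congr rfl fun k _ => ?_
    by_cases h : k = i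
    · subst h; simp
    · simp [Function.update_of_ne h, Function.update_comm (Ne.symm h)]
  map_eq_zero_of_eq' := by
    intro v i j hv hij
    have h0 : ∀ k, k ≠ i ∧ k ≠ j → Z (Function.update v k (W (v k))) = 0 := by
      intro k hk
      refine Z.map_eq_zero_of_eq _ (i := i) (j := j) ?_ hij
      rw [Function.update_of_ne hk.1.symm, Function.update_of_ne hk.2.symm, hv]
    rw [Fintype.sum_eq_add i j hij h0]
    have hs : Function.update v j (W (v j))
        = (Function.update v i (W (v i))) ∘ (Equiv.swap i j) := by
      funext k
      simp only [Function.comp_apply]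
      by_cases h1 : k = i
      · subst h1; simp [Function.update_of_ne hij, Function.update_of_ne hij.symm, hv]
      · by_cases h2 : k = j
        · subst h2; simp [hv]
        · rw [Equiv.swap_apply_of_ne_of_ne h1 h2, Function.update_of_ne h1,
            Function.update_of_ne h2]
    rw [hs, Z.map_swap _ hij, add_neg_cancel]

/-- The wedge product of two real `1`-forms. -/
def wedgeOne (a b : M [⋀^Fin 1]→ₗ[ℝ] ℝ) : M [⋀^Fin 2]→ₗ[ℝ] ℝ where
  toFun v := a ![v 0] * b ![v 1] - a ![v 1] * b ![v 0]
  map_update_add' := by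
    intro _ v i x y
    cases Subsingleton.elim ‹DecidableEq (Fin 2)› (instDecidableEqFin 2)
    have hu : ∀ z : M, (![z] : Fin 1 → M) = Function.update ![0] 0 z := fun z => by
      ext k; fin_cases k; simp
    have ha : ∀ x y, a ![x + y] = a ![x] + a ![y] := fun x y => by
      rw [hu, a.map_update_add, ← hu, ← hu]
    have hb : ∀ x y, b ![x + y] = b ![x] + b ![y] := fun x y => by
      rw [hu, b.map_update_add, ← hu, ← hu]
    fin_cases i <;> simp [ha, hb] <;> ring
  map_update_smul' := by
    intro _ v i r x
    cases Subsingleton.elim ‹DecidableEq (Fin 2)› (instDecidableEqFin 2)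
    have hu : ∀ z : M, (![z] : Fin 1 → M) = Function.update ![0] 0 z := fun z => by
      ext k; fin_cases k; simp
    have ha : ∀ x, a ![r • x] = r * a ![x] := fun x => by
      rw [hu, a.map_update_smul, ← hu, smul_eq_mul]
    have hb : ∀ x, b ![r • x] = r * b ![x] := fun x => by
      rw [hu, b.map_update_smul, ← hu, smul_eq_mul]
    fin_cases i <;> simp [ha, hb] <;> ring
  map_eq_zero_of_eq' := by
    intro v i j hv hij
    have h01 : v 0 = v 1 := by
      fin_cases i <;> fin_cases j <;> simp_all
    rw [h01]; ring

/-- For a family `A[lam]` of `1`-forms indexed by parameters `lam`, the value on two tangent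
vectors `u₁`, `u₂` of the `2`-form obtained from `A[lam]` by replacing `lam` with a `1`-form `w`
placed to the right, `A ∧ w`; here `w₁`, `w₂` are the values of `w` on the two vectors. -/
def placeRight {L : Type*} (A : L → M [⋀^Fin 1]→ₗ[ℝ] ℝ) (w₁ w₂ : L) (u₁ u₂ : M) : ℝ :=
  A w₂ ![u₁] - A w₁ ![u₂]

end Algebra

/-! ### Transfer field and Noether charges -/

section Charges

variable {E F : Type*} [AddCommGroup E] [Module ℝ E] [TopologicalSpace E]
  [AddCommGroup F] [Module ℝ F] [TopologicalSpace F]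
  {G : Type*} [Group G] [TopologicalSpace G] [ChartedSpace E G]
  {P : Set F} [MulAction G P]

variable (E G) in
/-- `δφ` as an `F`-valued `1`-form on the orbit. -/
noncomputable def deltaField (φ₀ : P) : OrbitForm E G φ₀ 1 F := fun ψ =>
  AlternatingMap.ofSubsingleton ℝ _ _ 0 (orbitTangent E G (ψ : P)).subtype

/-- `W` is the transfer field: the `1`-form valued vector field `V_w` on the orbit which, on the
variation produced by `dα` at `φ = T_α[φ₀]`, is the gauge transformation of `φ` generated by the
Lie algebra element `w(dα)`. -/
def IsTransferField (φ₀ : P) (W : OrbitTensor E G φ₀) : Prop :=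
  ∀ c ∈ atlas E G, ∀ α ∈ c.target, ∀ (dα : E)
    (u : orbitTangent E G (orbitPoint φ₀ c α : P)),
    (u : F) = fieldVariation φ₀ c α dα →
      W (orbitPoint φ₀ c α) u = generatorVec G (gaugeForm c α dα) (orbitPoint φ₀ c α : P)

/-- The function `h` on the orbit has a variation, and it is the `1`-form `A = δh`. -/
def HasVariation (φ₀ : P) (h : MulAction.orbit G φ₀ → ℝ) (A : OrbitForm E G φ₀ 1 ℝ) : Prop :=
  ∀ c ∈ atlas E G, ∀ α ∈ c.target, ∀ (dα : E)
    (u : orbitTangent E G (orbitPoint φ₀ c α : P)),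
    (u : F) = fieldVariation φ₀ c α dα →
      HasDirDeriv (fun α' => h (orbitPoint φ₀ c α')) (A (orbitPoint φ₀ c α) ![u]) α dα

/-- `h` is the Noether charge, with variation `dh`, of the gauge transformation with (possibly
state-dependent) parameter `ξ`: it satisfies `i_{V_ξ} Ω = - δh`. -/
def IsNoetherCharge (φ₀ : P) (Ω : OrbitForm E G φ₀ 2 ℝ) (ξ : MulAction.orbit G φ₀ → E)
    (h : MulAction.orbit G φ₀ → ℝ) (dh : OrbitForm E G φ₀ 1 ℝ) : Prop :=
  HasVariation φ₀ h dh ∧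
    ∀ ψ : MulAction.orbit G φ₀, (Ω ψ).curryLeft (generatorVec G (ξ ψ) (ψ : P)) = -dh ψ

end Charges

/-! ### Directional derivatives and the chain rule in locally convex spaces. -/

section DirectionalDerivative

variable {X Y Z : Type*} [AddCommGroup X] [Module ℝ X] [AddCommGroup Y] [Module ℝ Y]
  [TopologicalSpace Y] [AddCommGroup Z] [Module ℝ Z] [TopologicalSpace Z]

/-! The theorem says that on a gauge orbit the transfer field is the identity; the formulas then
become linear algebra. Since `T_α'[φ₀]` is `g(α') g(α)⁻¹` acting on `T_α[φ₀]`, the chain rule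
(`HasDirDeriv.comp_of_isC1On`) gives `δφ = V_w(φ)` (`hasDirDeriv_smul_eq_generator`). So `W` must
fix every `V_w`. These exhaust the tangent space: `V` is linear in the parameter, so the span of its
values is its range, and `w` takes every value in the Lie algebra (`gaugeForm_surjective`). Hence `W
= id` (`isTransferField_iff`) and `i_W Z = p Z`. For a 2-form, antisymmetry gives `2 Ω(u₁, u₂) =
Ω(u₁, u₂) - Ω(u₂, u₁)`, and each term is a charge variation because `uᵢ = V_{wᵢ}`. -/

theorem HasDirDeriv.unique [T2Space Y] {f : X → Y} {y z : Y} {x v : X}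
    (hy : HasDirDeriv f y x v) (hz : HasDirDeriv f z x v) : y = z :=
  tendsto_nhds_unique hy hz

theorem HasDirDeriv.dirDeriv_eq [T2Space Y] {f : X → Y} {y : Y} {x v : X}
    (h : HasDirDeriv f y x v) : dirDeriv f x v = y :=
  Tendsto.limUnder_eq h

theorem HasDirDeriv.congr_along {f g : X → Y} {y : Y} {x v : X} (h : HasDirDeriv f y x v)
    (hfg : ∀ᶠ t in 𝓝 (0 : ℝ), f (x + t • v) = g (x + t • v)) : HasDirDeriv g y x v := by
  have h0 : f x = g x := by simpa using hfg.self_of_nhds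
  refine Tendsto.congr' ?_ h
  filter_upwards [hfg.filter_mono nhdsWithin_le_nhds] with t ht
  rw [ht, h0]

theorem hasDirDeriv_id [TopologicalSpace X] (x v : X) :
    HasDirDeriv (fun x' : X => x') v x v := by
  refine tendsto_const_nhds.congr' ?_
  filter_upwards [self_mem_nhdsWithin] with t ht
  rw [add_sub_cancel_left, inv_smul_smul₀ ht]

theorem tendsto_add_smul [TopologicalSpace X] [IsTopologicalAddGroup X]
    [ContinuousSMul ℝ X] (x v : X) : Tendsto (fun t : ℝ => x + t • v) (𝓝 0) (𝓝 x) :=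
  Continuous.tendsto' (by fun_prop) _ _ (by simp)

/-- The mean value theorem for curves in a locally convex space. -/
theorem sub_mem_of_hasDirDeriv_mem [IsTopologicalAddGroup Y] [ContinuousSMul ℝ Y]
    [LocallyConvexSpace ℝ Y] {C : Set Y} (hC : Convex ℝ C) (hC' : IsClosed C) {p p' : ℝ → Y}
    (hp : ∀ τ ∈ Icc (0 : ℝ) 1, HasDirDeriv p (p' τ) τ 1) (hp' : ∀ τ ∈ Icc (0 : ℝ) 1, p' τ ∈ C) :
    p 1 - p 0 ∈ C := by
  by_contra hmem
  -- A separating functional reduces the claim to the scalar mean value theorem.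
  obtain ⟨l, u, hl, hu⟩ := geometric_hahn_banach_closed_point hC hC' hmem
  have hd : ∀ τ ∈ Icc (0 : ℝ) 1, HasDerivAt (fun τ => l (p τ)) (l (p' τ)) τ := by
    intro τ hτ
    rw [hasDerivAt_iff_tendsto_slope_zero]
    simpa [Function.comp_def] using (l.continuous.tendsto _).comp (hp τ hτ)
  obtain ⟨τ, hτ, h⟩ := exists_hasDerivAt_eq_slope (fun τ => l (p τ)) (fun τ => l (p' τ))
    zero_lt_one (fun τ hτ => (hd τ hτ).continuousAt.continuousWithinAt)
    (fun τ hτ => hd τ (Ioo_subset_Icc_self hτ))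
  have := hl _ (hp' τ (Ioo_subset_Icc_self hτ))
  rw [h, sub_zero, div_one, ← map_sub] at this
  exact lt_asymm this hu

theorem exists_isClosed_convex_mem_nhds_subset [IsTopologicalAddGroup Y] [ContinuousSMul ℝ Y]
    [LocallyConvexSpace ℝ Y] {y : Y} {U : Set Y} (hU : U ∈ 𝓝 y) :
    ∃ C ∈ 𝓝 y, IsClosed C ∧ Convex ℝ C ∧ C ⊆ U := by
  obtain ⟨A, ⟨hA, hA'⟩, hAU⟩ := (closed_nhds_basis y).mem_iff.1 hU
  obtain ⟨B, ⟨hB, hB'⟩, hBA⟩ := (LocallyConvexSpace.convex_basis (𝕜 := ℝ) y).mem_iff.1 hA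
  exact ⟨closure B, mem_of_superset hB subset_closure, isClosed_closure, hB'.closure,
    (closure_minimal hBA hA').trans hAU⟩

/-- The chain rule for a Bastiani `C¹` map and a directionally differentiable map. -/
theorem HasDirDeriv.comp_of_isC1On [TopologicalSpace X] [IsTopologicalAddGroup X]
    [ContinuousSMul ℝ X] [IsTopologicalAddGroup Y] [ContinuousSMul ℝ Y] [LocallyConvexSpace ℝ Y]
    {A : Type*} [AddCommGroup A] [Module ℝ A] [T2Space Y] {f : X → Y} {s : Set X}
    (hf : IsC1On f s) {γ : A → X} {a d : A} {w : X} {y : Y} (ha : γ a ∈ s)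
    (hγ : HasDirDeriv γ w a d) (hy : HasDirDeriv f y (γ a) w) :
    HasDirDeriv (fun a => f (γ a)) y a d := by
  obtain ⟨hs, f', hf', hcont⟩ := hf
  obtain rfl : f' (γ a) w = y := (hf' _ ha w).unique hy
  refine tendsto_def.2 fun U hU => ?_
  obtain ⟨C, hC, hCclosed, hCconv, hCU⟩ := exists_isClosed_convex_mem_nhds_subset hU
  have hnear : ∀ᶠ q : X × X in 𝓝 (γ a, w), q.1 ∈ s ∧ f' q.1 q.2 ∈ C := by
    have hopen : s ×ˢ (univ : Set X) ∈ 𝓝 (γ a, w) :=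
      (hs.prod isOpen_univ).mem_nhds ⟨ha, mem_univ _⟩
    filter_upwards [hopen, (hcont.continuousAt hopen).preimage_mem_nhds hC] with q h1 h2
    exact ⟨h1.1, h2⟩
  -- Without a norm, uniformity along the segment comes from compactness of `[0, 1]`. The direction
  -- varies too, since the difference quotient of `γ` only tends to `w`; this is where joint
  -- continuity of `f'` enters.
  have hunif : ∀ᶠ r : ℝ × X in 𝓝 (0, w), ∀ τ ∈ Icc (0 : ℝ) 1,
      γ a + τ • r.1 • r.2 ∈ s ∧ f' (γ a + τ • r.1 • r.2) r.2 ∈ C := by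
    refine isCompact_Icc.eventually_forall_of_forall_eventually fun τ _ => ?_
    have hc : Continuous fun z : (ℝ × X) × ℝ => (γ a + z.2 • z.1.1 • z.1.2, z.1.2) := by
      fun_prop
    exact (hc.tendsto' ((0, w), τ) (γ a, w) (by simp)).eventually hnear
  have hlim : Tendsto (fun t : ℝ => (t, t⁻¹ • (γ (a + t • d) - γ a))) (𝓝[≠] 0) (𝓝 (0, w)) :=
    (tendsto_nhdsWithin_of_tendsto_nhds tendsto_id).prodMk_nhds hγ
  filter_upwards [hlim.eventually hunif, self_mem_nhdsWithin] with t ht ht0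
  refine hCU ?_
  set v := t⁻¹ • (γ (a + t • d) - γ a) with hv
  have hend : γ (a + t • d) = γ a + t • v := by
    rw [hv, smul_inv_smul₀ ht0, add_sub_cancel]
  -- The factor `t⁻¹` cancels the length of the segment from `γ a` to `γ (a + t • d)`, so the
  -- derivative in `τ` is `f'` in the direction `v`, which lies in `C`.
  have := sub_mem_of_hasDirDeriv_mem hCconv hCclosed
    (p := fun τ => t⁻¹ • f (γ a + τ • t • v)) (p' := fun τ => f' (γ a + τ • t • v) v)
    (fun τ hτ => ?_) (fun τ hτ => (ht τ hτ).2)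
  · change t⁻¹ • (f (γ (a + t • d)) - f (γ a)) ∈ C
    rw [hend]
    simpa [smul_sub] using this
  · have h := (hf' _ (ht τ hτ).1 (t • v)).const_smul t⁻¹
    rw [map_smul, inv_smul_smul₀ ht0] at h
    refine h.congr fun r => ?_
    beta_reduce
    rw [smul_comm, smul_sub t⁻¹, smul_eq_mul, mul_one, add_smul, ← add_assoc]

end DirectionalDerivative

/-! ### Tangent vectors of the orbit and the transfer field. -/

section GaugeOrbit

variable {E F : Type*} [AddCommGroup E] [Module ℝ E] [TopologicalSpace E]
  [AddCommGroup F] [Module ℝ F] [TopologicalSpace F]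
  {G : Type*} [Group G] [TopologicalSpace G] [ChartedSpace E G]
  {P : Set F} [MulAction G P]

theorem generator_eq_linearMap [T2Space F] (hT : IsC1Action E G P) (φ : P) :
    ∃ V : E →ₗ[ℝ] F, ∀ lam, generator G lam φ = V lam ∧
      HasDirDeriv (fun β : E => (((chartAt E (1 : G)).symm β • φ : P) : F)) (V lam)
        (chartAt E (1 : G) 1) lam := by
  obtain ⟨-, f', hf', -⟩ := hT φ _ (chart_mem_atlas E (1 : G))
  have h := hf' _ (mem_chart_target E (1 : G))
  exact ⟨f' _, fun lam => ⟨(h lam).dirDeriv_eq, h lam⟩⟩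

variable [IsC1LieGroup E G]

theorem eventually_mul_inv_mem_source {c : OpenPartialHomeomorph G E} (hc : c ∈ atlas E G) {α : E}
    (hα : α ∈ c.target) :
    ∀ᶠ α' in 𝓝 α, α' ∈ c.target ∧ c.symm α' * (c.symm α)⁻¹ ∈ (chartAt E (1 : G)).source := by
  have hs := (IsC1LieGroup.c1_div c hc c hc _ (chart_mem_atlas E (1 : G))).1
  have hlim : Tendsto (fun α' : E => (α', α)) (𝓝 α) (𝓝 (α, α)) :=
    tendsto_id.prodMk_nhds tendsto_const_nhds
  filter_upwards [hlim.eventually (hs.mem_nhds ⟨hα, hα, by simp⟩)] with α' h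
  exact ⟨h.1, h.2.2⟩

theorem hasDirDeriv_gaugeForm [T2Space E] {c : OpenPartialHomeomorph G E}
    (hc : c ∈ atlas E G) {α : E}
    (hα : α ∈ c.target) (dα : E) :
    HasDirDeriv (fun α' : E => chartAt E (1 : G) (c.symm α' * (c.symm α)⁻¹))
      (gaugeForm c α dα) α dα := by
  obtain ⟨-, f', hf', -⟩ := IsC1LieGroup.c1_div c hc c hc _ (chart_mem_atlas E (1 : G))
  -- The zero second component freezes the factor `g(α)⁻¹`.
  have h := hf' (α, α) ⟨hα, hα, by simp⟩ (dα, 0)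
  have h' : HasDirDeriv (fun α' : E => chartAt E (1 : G) (c.symm α' * (c.symm α)⁻¹))
      (f' (α, α) (dα, 0)) α dα := by
    simpa [HasDirDeriv] using h
  rw [gaugeForm, h'.dirDeriv_eq]
  exact h'

variable [IsTopologicalAddGroup E] [ContinuousSMul ℝ E] [T2Space E]

/-- Every Lie algebra element is the value of `w` on some variation of the gauge parameters. -/
theorem gaugeForm_surjective [LocallyConvexSpace ℝ E] {c : OpenPartialHomeomorph G E}
    (hc : c ∈ atlas E G) {α : E}
    (hα : α ∈ c.target) : Function.Surjective (gaugeForm c α) := by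
  intro lam
  set c₁ := chartAt E (1 : G)
  set g := c.symm α with hg
  -- A chart at `g⁻¹` rather than `g`: dividing by `g⁻¹` is right translation by `g`. The preimage
  -- `dα` of `lam` is the derivative of this translation at the identity.
  set c₂ := chartAt E g⁻¹
  have hc₁ : c₁ ∈ atlas E G := chart_mem_atlas E 1
  have hc₂ : c₂ ∈ atlas E G := chart_mem_atlas E _
  have h1 : c₁.symm (c₁ 1) = 1 := c₁.left_inv (mem_chart_source E 1)
  have h2 : c₂.symm (c₂ g⁻¹) = g⁻¹ := c₂.left_inv (mem_chart_source E _)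
  have hgα : c g = α := c.right_inv hα
  obtain ⟨hopen, k', hk', -⟩ := IsC1LieGroup.c1_div c₁ hc₁ c₂ hc₂ c hc
  have hmem : (c₁ 1, c₂ g⁻¹) ∈ {q : E × E | q.1 ∈ c₁.target ∧ q.2 ∈ c₂.target ∧
      c₁.symm q.1 * (c₂.symm q.2)⁻¹ ∈ c.source} :=
    ⟨mem_chart_target E 1, mem_chart_target E _, by
      simpa [h1, h2] using c.map_target hα⟩
  have hk : HasDirDeriv (fun β : E => c (c₁.symm β * g)) (k' (c₁ 1, c₂ g⁻¹) (lam, 0))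
      (c₁ 1) lam := by
    simpa [HasDirDeriv, h2] using hk' _ hmem (lam, 0)
  set dα := k' (c₁ 1, c₂ g⁻¹) (lam, 0)
  refine ⟨dα, ?_⟩
  have hf := IsC1LieGroup.c1_div c hc c hc c₁ hc₁
  obtain ⟨-, f', hf', -⟩ := id hf
  have hαα : (α, α) ∈ {q : E × E | q.1 ∈ c.target ∧ q.2 ∈ c.target ∧
      c.symm q.1 * (c.symm q.2)⁻¹ ∈ c₁.source} := ⟨hα, hα, by simp [c₁]⟩
  have hw : gaugeForm c α dα = f' (α, α) (dα, 0) :=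
    (hasDirDeriv_gaugeForm hc hα dα).unique (by
      simpa [HasDirDeriv] using hf' _ hαα (dα, 0))
  have hbase : c (c₁.symm (c₁ 1) * g) = α := by rw [h1, one_mul, hgα]
  -- Division is known to be `C¹` as a map of pairs, so the translated curve is paired with the
  -- constant `α` before applying the chain rule.
  have hγ : HasDirDeriv (fun β : E => ((c (c₁.symm β * g), α) : E × E)) (dα, 0) (c₁ 1) lam := by
    have := Tendsto.prodMk_nhds hk (tendsto_const_nhds (x := (0 : E)))
    refine this.congr fun t => ?_
    ext <;> simp
  have hcomp := hγ.comp_of_isC1On hf (y := gaugeForm c α dα) (by rw [hbase]; exact hαα)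
    (by rw [hbase, hw]; exact hf' _ hαα _)
  -- Translating by `g` and then by `g⁻¹` is the identity near `c₁ 1`, so the composite derivative
  -- is also `lam`.
  refine hcomp.unique ((hasDirDeriv_id (c₁ 1) lam).congr_along ?_)
  have hlim : Tendsto (fun t : ℝ => (c₁ 1 + t • lam, c₂ g⁻¹)) (𝓝 0) (𝓝 (c₁ 1, c₂ g⁻¹)) :=
    (tendsto_add_smul _ _).prodMk_nhds tendsto_const_nhds
  filter_upwards [hlim.eventually (hopen.mem_nhds hmem)] with t ht
  obtain ⟨ht1, -, ht3⟩ := ht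
  rw [h2, inv_inv] at ht3
  rw [c.left_inv ht3, ← hg, mul_inv_cancel_right, c₁.right_inv ht1]

variable [IsTopologicalAddGroup F] [ContinuousSMul ℝ F] [LocallyConvexSpace ℝ F] [T2Space F]

/-- Factor `T_α' = T_{g(α') g(α)⁻¹} T_α`: the first factor passes through the identity at `α' = α`
with velocity `w`. The factorization in charts is valid only near `α`, which suffices for a
derivative. -/
theorem hasDirDeriv_smul_eq_generator (hT : IsC1Action E G P) (φ₀ : P)
    {c : OpenPartialHomeomorph G E} (hc : c ∈ atlas E G) {α : E} (hα : α ∈ c.target) (dα : E) :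
    HasDirDeriv (fun α' : E => ((c.symm α' • φ₀ : P) : F))
      (generator G (gaugeForm c α dα) (orbitPoint φ₀ c α : P)) α dα := by
  obtain ⟨V, hV⟩ := generator_eq_linearMap hT (orbitPoint φ₀ c α : P)
  rw [(hV _).1]
  have hbase : chartAt E (1 : G) (c.symm α * (c.symm α)⁻¹) = chartAt E (1 : G) 1 := by
    rw [mul_inv_cancel]
  have h := (hasDirDeriv_gaugeForm hc hα dα).comp_of_isC1On
    (hT (orbitPoint φ₀ c α : P) _ (chart_mem_atlas E (1 : G)))
    (y := V (gaugeForm c α dα)) (by rw [hbase]; exact mem_chart_target E 1)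
    (by rw [hbase]; exact (hV _).2)
  refine h.congr_along ?_
  filter_upwards [(tendsto_add_smul α dα).eventually (eventually_mul_inv_mem_source hc hα)]
    with t ht
  rw [(chartAt E (1 : G)).left_inv ht.2, orbitPoint, smul_smul, inv_mul_cancel_right]

theorem fieldVariation_eq_generator (hT : IsC1Action E G P) (φ₀ : P)
    {c : OpenPartialHomeomorph G E} (hc : c ∈ atlas E G) {α : E} (hα : α ∈ c.target) (dα : E) :
    fieldVariation φ₀ c α dα = generator G (gaugeForm c α dα) (orbitPoint φ₀ c α : P) :=
  (hasDirDeriv_smul_eq_generator hT φ₀ hc hα dα).dirDeriv_eq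

theorem eq_generatorVec_of_eq_fieldVariation (hT : IsC1Action E G P) (φ₀ : P)
    {c : OpenPartialHomeomorph G E} (hc : c ∈ atlas E G) {α : E} (hα : α ∈ c.target) {dα : E}
    {u : orbitTangent E G (orbitPoint φ₀ c α : P)} (hu : (u : F) = fieldVariation φ₀ c α dα) :
    u = generatorVec G (gaugeForm c α dα) (orbitPoint φ₀ c α : P) :=
  Subtype.ext (hu.trans (fieldVariation_eq_generator hT φ₀ hc hα dα))

/-- On the orbit the transfer field is the identity. -/
theorem isTransferField_iff [LocallyConvexSpace ℝ E] (hT : IsC1Action E G P) (φ₀ : P)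
    (W : OrbitTensor E G φ₀) :
    IsTransferField φ₀ W ↔ W = fun _ => LinearMap.id := by
  constructor
  · intro hW
    funext ψ
    obtain ⟨_, g, rfl⟩ := ψ
    obtain ⟨c, hc, α, hα, hψ⟩ : ∃ c ∈ atlas E G, ∃ α ∈ c.target,
        orbitPoint φ₀ c α = ⟨g • φ₀, MulAction.mem_orbit φ₀ g⟩ :=
      ⟨chartAt E g, chart_mem_atlas E g, chartAt E g g, mem_chart_target E g,
        Subtype.ext (congrArg (· • φ₀) ((chartAt E g).left_inv (mem_chart_source E g)))⟩
    change W ⟨g • φ₀, MulAction.mem_orbit φ₀ g⟩ = LinearMap.id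
    rw [← hψ]
    obtain ⟨V, hV⟩ := generator_eq_linearMap hT (orbitPoint φ₀ c α : P)
    ext ⟨u, hu⟩
    -- Every tangent vector is a single generator, not merely a combination of them.
    obtain ⟨lam, rfl⟩ : ∃ lam, generator G lam (orbitPoint φ₀ c α : P) = u := by
      have hspan : orbitTangent E G (orbitPoint φ₀ c α : P) = LinearMap.range V := by
        rw [orbitTangent, funext fun lam => (hV lam).1, ← LinearMap.coe_range, Submodule.span_eq]
      rw [hspan] at hu
      obtain ⟨lam, rfl⟩ := hu
      exact ⟨lam, (hV lam).1⟩
    obtain ⟨dα, rfl⟩ := gaugeForm_surjective hc hα lam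
    rw [hW c hc α hα dα _ (fieldVariation_eq_generator hT φ₀ hc hα dα).symm]
    rfl
  · rintro rfl c hc α hα dα u hu
    exact eq_generatorVec_of_eq_fieldVariation hT φ₀ hc hα hu

end GaugeOrbit

/-! ### Contraction with the identity, and 2-forms determined by charges. -/

section Contraction

variable {M N : Type*} [AddCommGroup M] [Module ℝ M] [AddCommGroup N] [Module ℝ N]

theorem insertTensor_id {p : ℕ} (Z : M [⋀^Fin p]→ₗ[ℝ] N) :
    insertTensor LinearMap.id Z = (p : ℝ) • Z := by
  ext v
  simp [insertTensor, Nat.cast_smul_eq_nsmul]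

theorem wedgeOne_swap (a b : M [⋀^Fin 1]→ₗ[ℝ] ℝ) : wedgeOne b a = -wedgeOne a b := by
  ext v
  simp only [wedgeOne, AlternatingMap.coe_mk, MultilinearMap.coe_mk, AlternatingMap.neg_apply]
  ring

theorem two_mul_eq_of_curryLeft_eq_neg {Ω : M [⋀^Fin 2]→ₗ[ℝ] N}
    {A₁ A₂ : M [⋀^Fin 1]→ₗ[ℝ] N} {u₁ u₂ : M} (h₁ : Ω.curryLeft u₁ = -A₁)
    (h₂ : Ω.curryLeft u₂ = -A₂) : (2 : ℝ) • Ω ![u₁, u₂] = A₂ ![u₁] - A₁ ![u₂] := by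
  have e₁ : Ω ![u₁, u₂] = -A₁ ![u₂] := DFunLike.congr_fun h₁ ![u₂]
  have e₂ : Ω ![u₂, u₁] = -A₂ ![u₁] := DFunLike.congr_fun h₂ ![u₁]
  have hswap : Ω ![u₂, u₁] = -Ω ![u₁, u₂] := by
    rw [← Ω.map_swap ![u₁, u₂] (i := 0) (j := 1) (by decide)]
    congr 1
    ext i
    fin_cases i <;> simp
  rw [two_smul]
  nth_rw 2 [← neg_neg (Ω ![u₁, u₂])]
  rw [← hswap, e₂, e₁]
  abel

end Contraction

theorem mainTheorem2
    {E F G N : Type*}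
    [AddCommGroup E] [Module ℝ E] [TopologicalSpace E] [IsTopologicalAddGroup E]
    [ContinuousSMul ℝ E] [LocallyConvexSpace ℝ E] [T2Space E]
    [AddCommGroup F] [Module ℝ F] [TopologicalSpace F] [IsTopologicalAddGroup F]
    [ContinuousSMul ℝ F] [LocallyConvexSpace ℝ F] [T2Space F]
    [Group G] [TopologicalSpace G] [ChartedSpace E G] [IsC1LieGroup E G]
    [AddCommGroup N] [Module ℝ N]
    {P : Set F} [MulAction G P] (hT : IsC1Action E G P) (φ₀ : P) :
    -- on the orbit, a variation of `φ = T_α[φ₀]` is the infinitesimal transformation by `w`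
    (∀ c ∈ atlas E G, ∀ α ∈ c.target, ∀ dα : E,
      HasDirDeriv (fun α' : E => ((c.symm α' • φ₀ : P) : F))
        (generator G (gaugeForm c α dα) (orbitPoint φ₀ c α : P)) α dα) ∧
    -- the transfer field exists and is unique
    (∃! W : OrbitTensor E G φ₀, IsTransferField φ₀ W) ∧
    ∀ W : OrbitTensor E G φ₀, IsTransferField φ₀ W →
      -- `δφ = i_W δφ`
      (∀ ψ, deltaField E G φ₀ ψ = insertTensor (W ψ) (deltaField E G φ₀ ψ)) ∧
      -- `i_W Z = p Z` for every `p`-form `Z` (with values in any vector space `N`)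
      (∀ (p : ℕ) (Z : OrbitForm E G φ₀ p N) (ψ : MulAction.orbit G φ₀),
        insertTensor (W ψ) (Z ψ) = (p : ℝ) • Z ψ) ∧
      -- `i_W (a ∧ b) = - [b ∧ i_W a - a ∧ i_W b]`
      (∀ (a b : OrbitForm E G φ₀ 1 ℝ) (ψ : MulAction.orbit G φ₀),
        insertTensor (W ψ) (wedgeOne (a ψ) (b ψ)) =
          -(wedgeOne (b ψ) (insertTensor (W ψ) (a ψ)) -
            wedgeOne (a ψ) (insertTensor (W ψ) (b ψ)))) ∧
      ∀ Ω : OrbitForm E G φ₀ 2 ℝ,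
        -- `i_W Ω = (δH[w'])|_{w' = w}` and `Ω = ½ (δH[w'])|_{w' = w}`
        (∀ (H : E → MulAction.orbit G φ₀ → ℝ) (dH : E → OrbitForm E G φ₀ 1 ℝ),
          (∀ lam : E, IsNoetherCharge φ₀ Ω (fun _ => lam) (H lam) (dH lam)) →
          ∀ c ∈ atlas E G, ∀ α ∈ c.target, ∀ (dα₁ dα₂ : E)
            (u₁ u₂ : orbitTangent E G (orbitPoint φ₀ c α : P)),
            (u₁ : F) = fieldVariation φ₀ c α dα₁ → (u₂ : F) = fieldVariation φ₀ c α dα₂ →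
            insertTensor (W (orbitPoint φ₀ c α)) (Ω (orbitPoint φ₀ c α)) ![u₁, u₂] =
              placeRight (fun lam => dH lam (orbitPoint φ₀ c α))
                (gaugeForm c α dα₁) (gaugeForm c α dα₂) u₁ u₂ ∧
            Ω (orbitPoint φ₀ c α) ![u₁, u₂] =
              (1 / 2 : ℝ) * placeRight (fun lam => dH lam (orbitPoint φ₀ c α))
                (gaugeForm c α dα₁) (gaugeForm c α dα₂) u₁ u₂) ∧
        -- the same with state-dependent gauge parameters `ξ₁`, `ξ₂` taking the values of `w`
        (∀ (ξ₁ ξ₂ : MulAction.orbit G φ₀ → E) (h₁ h₂ : MulAction.orbit G φ₀ → ℝ)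
          (dh₁ dh₂ : OrbitForm E G φ₀ 1 ℝ),
          IsNoetherCharge φ₀ Ω ξ₁ h₁ dh₁ → IsNoetherCharge φ₀ Ω ξ₂ h₂ dh₂ →
          ∀ c ∈ atlas E G, ∀ α ∈ c.target, ∀ (dα₁ dα₂ : E)
            (u₁ u₂ : orbitTangent E G (orbitPoint φ₀ c α : P)),
            (u₁ : F) = fieldVariation φ₀ c α dα₁ → (u₂ : F) = fieldVariation φ₀ c α dα₂ →
            ξ₁ (orbitPoint φ₀ c α) = gaugeForm c α dα₁ →
            ξ₂ (orbitPoint φ₀ c α) = gaugeForm c α dα₂ →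
            Ω (orbitPoint φ₀ c α) ![u₁, u₂] =
              (1 / 2 : ℝ) * (dh₂ (orbitPoint φ₀ c α) ![u₁] -
                dh₁ (orbitPoint φ₀ c α) ![u₂])) := by
  refine ⟨fun c hc α hα dα => hasDirDeriv_smul_eq_generator hT φ₀ hc hα dα,
    ⟨_, (isTransferField_iff hT φ₀ _).2 rfl, fun W hW => (isTransferField_iff hT φ₀ W).1 hW⟩, ?_⟩
  intro W hW
  obtain rfl := (isTransferField_iff hT φ₀ W).1 hW
  refine ⟨fun ψ => ?_, fun p Z ψ => insertTensor_id _, fun a b ψ => ?_, fun Ω => ⟨?_, ?_⟩⟩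
  · rw [insertTensor_id, Nat.cast_one, one_smul]
  · simp only [insertTensor_id, Nat.cast_one, one_smul]
    -- With `W = id` both sides equal `2 a ∧ b`.
    rw [wedgeOne_swap (a ψ) (b ψ), Nat.cast_ofNat, two_smul]
    abel
  · intro H dH hH c hc α hα dα₁ dα₂ u₁ u₂ hu₁ hu₂
    -- The charge identities for the parameters `w₁`, `w₂` become identities for `u₁`, `u₂`, since
    -- `uᵢ = V_{wᵢ}`.
    have key := two_mul_eq_of_curryLeft_eq_neg (u₁ := u₁) (u₂ := u₂)
      (eq_generatorVec_of_eq_fieldVariation hT φ₀ hc hα hu₁ ▸ (hH _).2 (orbitPoint φ₀ c α))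
      (eq_generatorVec_of_eq_fieldVariation hT φ₀ hc hα hu₂ ▸ (hH _).2 (orbitPoint φ₀ c α))
    rw [insertTensor_id, placeRight, ← key]
    exact ⟨by simp, by simp⟩
  · intro ξ₁ ξ₂ h₁ h₂ dh₁ dh₂ hh₁ hh₂ c hc α hα dα₁ dα₂ u₁ u₂ hu₁ hu₂ hξ₁ hξ₂
    -- The charge identity is pointwise in `φ`, so only the values of `ξ₁`, `ξ₂` at this point
    -- matter.
    have e₁ := hh₁.2 (orbitPoint φ₀ c α)
    have e₂ := hh₂.2 (orbitPoint φ₀ c α)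
    rw [hξ₁, ← eq_generatorVec_of_eq_fieldVariation hT φ₀ hc hα hu₁] at e₁
    rw [hξ₂, ← eq_generatorVec_of_eq_fieldVariation hT φ₀ hc hα hu₂] at e₂
    rw [← two_mul_eq_of_curryLeft_eq_neg e₁ e₂]
    simp
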